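/- Let $\mathbb F_q$ be a finite field. An $[n,k]$ code is a $k$-dimensional subspace $\mathcal C\subseteq\mathbb F_q^n$; a generator matrix of a code is a matrix whose rows form a basis of it. Put $\mathrm{Hull}(\mathcal C)=\mathcal C\cap\mathcal C^{\perp}$, where $\mathcal C^\perp=\{v:\langle u,v\rangle=0\ \forall u\in\mathcal C\}$ and either $\langle u,v\rangle=\sum_i u_iv_i$ (Euclidean case) or, if $q$ is an even power of a prime, $\langle u,v\rangle=\sum_i u_iv_i^{\sqrt q}$ (Hermitian case). A $t$-dimensional hull embedding of an $[n,k]$ code $\mathcal C$ is an $[n',k]$ code $\widetilde{\mathcal C}$ over $\mathbb F_q$, $n'\ge n$, with $\dim\mathrm{Hull}(\widetilde{\mathcal C})=t$, such that $\mathcal C$ is obtained from $\widetilde{\mathcal C}$ by deleting the coordinates in some set $S$; it is shortest if $n'$ is minimal among all $t$-dimensional hull embeddings of $\mathcal C$. In the Euclidean case let $G$ be a generator matrix of $\mathcal C$, and write $M\simeq N$ if $N=PMP^T$ with $P$ invertible. For $q$ odd, $\mathcal C$ is of type $\mathrm E_{o,s}$ if $-GG^T\simeq\mathrm{diag}(I_r,O)$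 for some $r$, and of type $\mathrm E_{o,ns}$ if $-GG^T\simeq\mathrm{diag}(I_{r-1},z,O)$ for some $r\ge1$ and some non-square $z\in\mathbb F_q$. For $q$ even, $\mathcal C$ is of type $\mathrm E_{e,a}$ if $GG^T$ is alternating (skew-symmetric with zero diagonal), and of type $\mathrm E_{e,na}$ otherwise. Let $\mathcal C$ be an $[n,k]$ code over $\mathbb F_q$, $\ell=\dim\mathrm{Hull}(\mathcal C)$, $\ell<t\le k$, and let $\widetilde{\mathcal C}$ be a shortest $t$-dimensional hull embedding of $\mathcal C$ with a generator matrix $$\widetilde G=\begin{bmatrix}G(\mathrm{Hull}(\mathcal C))&D_1\\A&D_2\end{bmatrix},$$ where $G(\mathrm{Hull}(\mathcal C))$ is a generator matrix of $\mathrm{Hull}(\mathcal C)$ and $\begin{bmatrix}G(\mathrm{Hull}(\mathcal C))\\A\end{bmatrix}$ is a generator matrix of $\mathcal C$. Then: 1. in the Hermitian case, $\mathrm{rank}(D_2)=t-\ell$; 2. in the Euclidean case, if $\mathcal C$ is of type $\mathrm E_{o,s}$, $\mathrm E_{o,ns}$ or $\mathrm E_{e,na}$, then $\mathrm{rank}(D_2)=t-\ell$;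 3. in the Euclidean case, if $\mathcal C$ is of type $\mathrm E_{e,a}$, then $\mathrm{rank}(D_2)\in\{t-\ell,\,t-\ell+1\}$. Moreover, both values in 3 occur: over every finite field of characteristic $2$ there are such $\mathcal C$ of type $\mathrm E_{e,a}$, $t$, $\widetilde{\mathcal C}$ and $\widetilde G$ with $\mathrm{rank}(D_2)=t-\ell$, and others with $\mathrm{rank}(D_2)=t-\ell+1$. -/

import Mathlib

namespace HullEmbedding

open Matrix Module

variable {F : Type*} [Field F]

/-- The dual of a code `C ⊆ F^n` for the form `⟨u, v⟩ = ∑ i, u i * σ (v i)`. It is the Euclidean dual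
for `σ = RingHom.id F`, and the Hermitian dual for `σ = iterateFrobenius F p a`, `|F| = (p ^ a) ^ 2`. -/
def dual (σ : F →+* F) {n : ℕ} (C : Submodule F (Fin n → F)) : Submodule F (Fin n → F) where
  carrier := {v | ∀ u ∈ C, ∑ i, u i * σ (v i) = 0}
  zero_mem' := by
    intro u _
    simp
  add_mem' := by
    intro v w hv hw u hu
    simp only [Pi.add_apply, map_add, mul_add, Finset.sum_add_distrib]
    rw [hv u hu, hw u hu, add_zero]
  smul_mem' := by
    intro c v hv u hu
    have h : ∑ i, u i * σ ((c • v) i) = σ c * ∑ i, u i * σ (v i) := by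
      rw [Finset.mul_sum]
      refine Finset.sum_congr rfl fun i _ => ?_
      simp only [Pi.smul_apply, smul_eq_mul, map_mul]
      ring
    rw [h, hv u hu, mul_zero]

theorem mem_dual_id {n : ℕ} (C : Submodule F (Fin n → F)) (v : Fin n → F) :
    v ∈ dual (RingHom.id F) C ↔ ∀ u ∈ C, ∑ i, u i * v i = 0 :=
  Iff.rfl

theorem mem_dual_iterateFrobenius (p a : ℕ) [ExpChar F p] {n : ℕ} (C : Submodule F (Fin n → F))
    (v : Fin n → F) :
    v ∈ dual (iterateFrobenius F p a) C ↔ ∀ u ∈ C, ∑ i, u i * v i ^ (p ^ a) = 0 :=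
  Iff.rfl

/-- `Hull(C) = C ∩ C^⊥`. -/
def hull (σ : F →+* F) {n : ℕ} (C : Submodule F (Fin n → F)) : Submodule F (Fin n → F) :=
  C ⊓ dual σ C

/-- The rows of `G` form a basis of the code `C`. -/
def IsGeneratorMatrix {ι : Type*} {n : ℕ} (G : Matrix ι (Fin n) F)
    (C : Submodule F (Fin n → F)) : Prop :=
  LinearIndependent F G.row ∧ Submodule.span F (Set.range G.row) = C

/-- `C` is obtained from `C'` by deleting the coordinates in some set `S`
(the remaining coordinates are kept in their order). -/
def IsPuncturing {n n' : ℕ} (C' : Submodule F (Fin n' → F)) (C : Submodule F (Fin n → F)) : Prop :=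
  ∃ (S : Finset (Fin n')) (h : Sᶜ.card = n),
    C'.map (LinearMap.funLeft F F (Sᶜ.orderEmbOfFin h)) = C

/-- `C'` is a `t`-dimensional hull embedding of `C`. -/
structure IsHullEmbedding (σ : F →+* F) (t : ℕ) {n n' : ℕ} (C : Submodule F (Fin n → F))
    (C' : Submodule F (Fin n' → F)) : Prop where
  length_le : n ≤ n'
  finrank_eq : finrank F C' = finrank F C
  finrank_hull : finrank F (hull σ C') = t
  puncturing : IsPuncturing C' C

/-- `C'` is a `t`-dimensional hull embedding of `C` of minimal length. -/
def IsShortestHullEmbedding (σ : F →+* F) (t : ℕ) {n n' : ℕ} (C : Submodule F (Fin n → F))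
    (C' : Submodule F (Fin n' → F)) : Prop :=
  IsHullEmbedding σ t C C' ∧
    ∀ (m : ℕ) (C'' : Submodule F (Fin m → F)), IsHullEmbedding σ t C C'' → n' ≤ m

/-- With `ℓ = dim Hull(C)` and `ℓ < t ≤ dim C`, the code `C'` is a shortest `t`-dimensional hull
embedding of `C` that has the generator matrix `[[H, D₁], [A, D₂]]`, where `H` is a generator matrix
of `Hull(C)` and `[H; A]` is a generator matrix of `C`. -/
structure IsBlockEmbedding (σ : F →+* F) (t : ℕ) {n s ℓ m : ℕ} (C : Submodule F (Fin n → F))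
    (C' : Submodule F (Fin (n + s) → F))
    (H : Matrix (Fin ℓ) (Fin n) F) (D₁ : Matrix (Fin ℓ) (Fin s) F)
    (A : Matrix (Fin m) (Fin n) F) (D₂ : Matrix (Fin m) (Fin s) F) : Prop where
  finrank_hull : finrank F (hull σ C) = ℓ
  hull_lt : ℓ < t
  le_finrank : t ≤ finrank F C
  shortest : IsShortestHullEmbedding σ t C C'
  hull_generator : IsGeneratorMatrix H (hull σ C)
  code_generator : IsGeneratorMatrix (fromRows H A) C
  embedding_generator :
    IsGeneratorMatrix ((fromBlocks H D₁ A D₂).submatrix id finSumFinEquiv.symm) C'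

/-- Congruence of square matrices (with respect to the transpose). -/
def IsCongruent {k : ℕ} (M N : Matrix (Fin k) (Fin k) F) : Prop :=
  ∃ P : Matrix (Fin k) (Fin k) F, IsUnit P ∧ P * M * Pᵀ = N

/-- Alternating matrices: zero diagonal and skew-symmetric. -/
def IsAlternating {k : ℕ} (M : Matrix (Fin k) (Fin k) F) : Prop :=
  (∀ i, M i i = 0) ∧ ∀ i j, M i j = -M j i

/-- Type `E_{o,s}`: odd characteristic and `-GGᵀ ≃ diag(I_r, O)`. -/
def IsTypeOddSquare {n : ℕ} (C : Submodule F (Fin n → F)) : Prop :=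
  ringChar F ≠ 2 ∧ ∃ (k : ℕ) (G : Matrix (Fin k) (Fin n) F), IsGeneratorMatrix G C ∧
    ∃ r ≤ k, IsCongruent (-(G * Gᵀ)) (diagonal fun i => if (i : ℕ) < r then 1 else 0)

/-- Type `E_{o,ns}`: odd characteristic and `-GGᵀ ≃ diag(I_{r-1}, z, O)` with `z` a non-square. -/
def IsTypeOddNonsquare {n : ℕ} (C : Submodule F (Fin n → F)) : Prop :=
  ringChar F ≠ 2 ∧ ∃ (k : ℕ) (G : Matrix (Fin k) (Fin n) F), IsGeneratorMatrix G C ∧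
    ∃ r ≤ k, 1 ≤ r ∧ ∃ z : F, ¬ IsSquare z ∧ IsCongruent (-(G * Gᵀ))
      (diagonal fun i => if (i : ℕ) + 1 < r then 1 else if (i : ℕ) + 1 = r then z else 0)

/-- Type `E_{e,a}`: characteristic two and `GGᵀ` alternating. -/
def IsTypeEvenAlternating {n : ℕ} (C : Submodule F (Fin n → F)) : Prop :=
  ringChar F = 2 ∧ ∃ (k : ℕ) (G : Matrix (Fin k) (Fin n) F), IsGeneratorMatrix G C ∧
    IsAlternating (G * Gᵀ)

/-- Type `E_{e,na}`: characteristic two and `GGᵀ` non-alternating. -/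
def IsTypeEvenNonalternating {n : ℕ} (C : Submodule F (Fin n → F)) : Prop :=
  ringChar F = 2 ∧ ∃ (k : ℕ) (G : Matrix (Fin k) (Fin n) F), IsGeneratorMatrix G C ∧
    ¬ IsAlternating (G * Gᵀ)

end HullEmbedding

/-! The rank of `D₂` is squeezed between two bounds. Below: a hull word of the extended code is
determined by its `H`-coefficients together with the combination of rows of `D₂` it uses, so `t ≤ ℓ
+ D₂.rank` (`IsBlockEmbedding.le_add_rank`). Above: `D₂` has `dim C - ℓ` rows, which settles `t =
dim C`; for `t < dim C` its number of columns is the minimal number of new coordinates, so a short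
embedding has to be built (`IsBlockEmbedding.rank_le`).

A code is treated as a space with the pulled-back form, its hull being the radical. Adjoining the
coordinate `⟨·, v⟩` with `⟨v, v⟩ = -1` adds exactly the line of `v` to the radical. While the
radical has dimension below `t < dim C`, the form has rank at least 2, enough to represent `-1` in
the Hermitian, odd and non-alternating cases; thus `t - ℓ` coordinates suffice. An alternating form
in characteristic 2 represents only 0, and one preliminary coordinate makes it non-alternating
without changing the radical, whence the extra 1.

Both values occur for the even weight code of length 3, a hyperbolic plane: the larger for `t = 1`,
the smaller for `t = 2`. -/

namespace HullEmbedding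

open Matrix Module

variable {F : Type*} [Field F]

/-! ### Radicals of pulled-back forms and the effect of a new coordinate. -/

section Radical

variable {V : Type*} [AddCommGroup V] [Module F V]

/-- The sesquilinear form `⟨φ x, φ y⟩` pulled back along a linear map `φ : V → F^n`. -/
def pairing (σ : F →+* F) {n : ℕ} (φ : V →ₗ[F] (Fin n → F)) (x y : V) : F :=
  ∑ i, φ x i * σ (φ y i)

/-- The radical of the form `pairing σ φ`. -/
def radical (σ : F →+* F) {n : ℕ} (φ : V →ₗ[F] (Fin n → F)) : Submodule F V :=
  (dual σ (LinearMap.range φ)).comap φ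

variable {σ : F →+* F} {n : ℕ} {φ : V →ₗ[F] (Fin n → F)}

theorem mem_radical {y : V} : y ∈ radical σ φ ↔ ∀ x, pairing σ φ x y = 0 := by
  simp [radical, pairing, dual]

theorem pairing_add_left (x x' y : V) :
    pairing σ φ (x + x') y = pairing σ φ x y + pairing σ φ x' y := by
  simp [pairing, add_mul, Finset.sum_add_distrib]

theorem pairing_smul_left (c : F) (x y : V) :
    pairing σ φ (c • x) y = c * pairing σ φ x y := by
  simp [pairing, Finset.mul_sum, mul_assoc]

theorem pairing_add_right (x y y' : V) :
    pairing σ φ x (y + y') = pairing σ φ x y + pairing σ φ x y' := by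
  simp [pairing, mul_add, Finset.sum_add_distrib]

theorem pairing_smul_right (c : F) (x y : V) :
    pairing σ φ x (c • y) = σ c * pairing σ φ x y := by
  simp [pairing, Finset.mul_sum, mul_left_comm]

theorem pairing_symm (hσ : ∀ x, σ (σ x) = x) (x y : V) :
    pairing σ φ y x = σ (pairing σ φ x y) := by
  simp [pairing, map_sum, hσ, mul_comm]

theorem pairing_comm (φ : V →ₗ[F] (Fin n → F)) (x y : V) :
    pairing (RingHom.id F) φ y x = pairing (RingHom.id F) φ x y :=
  pairing_symm (fun _ => rfl) x y

/-- Adjoin to `φ` one further coordinate, the functional `⟨·, v⟩`. -/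
def adjoin (σ : F →+* F) (φ : V →ₗ[F] (Fin n → F)) (v : V) : V →ₗ[F] (Fin (n + 1) → F) where
  toFun x := Fin.snoc (α := fun _ => F) (φ x) (pairing σ φ x v)
  map_add' x y := by
    ext i
    refine Fin.lastCases ?_ (fun j => ?_) i <;> simp [pairing_add_left]
  map_smul' c x := by
    ext i
    refine Fin.lastCases ?_ (fun j => ?_) i <;> simp [pairing_smul_left]

theorem adjoin_castSucc (v x : V) (i : Fin n) : adjoin σ φ v x i.castSucc = φ x i := by
  simp [adjoin]

theorem pairing_adjoin (v x y : V) : pairing σ (adjoin σ φ v) x y =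
    pairing σ φ x y + pairing σ φ x v * σ (pairing σ φ y v) := by
  rw [pairing, Fin.sum_univ_castSucc]
  simp [adjoin, pairing]

/-- The new pairing of `x` with `y` is the old pairing of `x` with `y + ⟨y, v⟩ v`, so the new
radical consists of the `y` for which that vector lies in the old one; for `y = v` it is 0. -/
theorem radical_adjoin_of_neg_one (hσ : ∀ x, σ (σ x) = x) {v : V} (hv : pairing σ φ v v = -1) :
    radical σ (adjoin σ φ v) = radical σ φ ⊔ Submodule.span F {v} := by
  apply le_antisymm
  · intro y hy
    rw [mem_radical] at hy
    have h : y + pairing σ φ y v • v ∈ radical σ φ := by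
      rw [mem_radical]
      intro x
      rw [pairing_add_right, pairing_smul_right, mul_comm (σ _), ← pairing_adjoin, hy]
    rw [Submodule.mem_sup]
    exact ⟨_, h, -(pairing σ φ y v) • v,
      Submodule.smul_mem _ _ (Submodule.mem_span_singleton_self v), by simp⟩
  · refine sup_le (fun y hy => ?_) ?_
    · rw [mem_radical] at hy ⊢
      intro x
      rw [pairing_adjoin, hy, pairing_symm hσ v y, hy]
      simp
    · rw [Submodule.span_singleton_le_iff_mem, mem_radical]
      intro x
      rw [pairing_adjoin, hv]
      simp

theorem finrank_radical_adjoin [FiniteDimensional F V] (hσ : ∀ x, σ (σ x) = x) {v : V}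
    (hv : pairing σ φ v v = -1) :
    finrank F (radical σ (adjoin σ φ v)) = finrank F (radical σ φ) + 1 := by
  rw [radical_adjoin_of_neg_one hσ hv]
  have hv' : v ∉ radical σ φ := by
    intro h
    rw [mem_radical] at h
    simp [h v] at hv
  have hv0 : v ≠ 0 := fun h => hv' (h ▸ Submodule.zero_mem _)
  have hd : Disjoint (radical σ φ) (Submodule.span F {v}) := by
    rw [Submodule.disjoint_span_singleton' hv0]
    exact hv'
  have := Submodule.finrank_sup_add_finrank_inf_eq (radical σ φ) (Submodule.span F {v})
  rw [hd.eq_bot, finrank_bot, finrank_span_singleton hv0] at this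
  simpa using this

/-- Since `⟨w, w⟩ = 0`, pairings with `w` do not change. A vector of either radical is therefore
orthogonal to `w`, and for it the correction term vanishes. -/
theorem radical_adjoin_of_isotropic (hσ : ∀ x, σ (σ x) = x) {w : V} (hw : pairing σ φ w w = 0) :
    radical σ (adjoin σ φ w) = radical σ φ := by
  ext y
  simp only [mem_radical, pairing_adjoin]
  constructor
  · intro h
    have h0 : pairing σ φ y w = 0 := by
      have := h w
      rw [hw, zero_mul, add_zero] at this
      rw [pairing_symm hσ w y, this, map_zero]
    intro x
    simpa [h0] using h x
  · intro h x
    rw [h, pairing_symm hσ w y, h]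
    simp

theorem exists_pairing_ne_zero [FiniteDimensional F V]
    (h : finrank F (radical σ φ) < finrank F V) : ∃ x y, pairing σ φ x y ≠ 0 := by
  by_contra! hc
  have : radical σ φ = ⊤ := by
    ext y
    simp [mem_radical, hc]
  rw [this, finrank_top] at h
  exact lt_irrefl _ h

/-- As `v` is anisotropic, its line splits off. If the form vanished on the orthogonal complement,
that complement would lie in the radical, whose codimension would then be at most 1. -/
theorem exists_pairing_ne_zero_of_orthogonal [FiniteDimensional F V] {v : V}
    (hv : pairing (RingHom.id F) φ v v ≠ 0)
    (h : finrank F (radical (RingHom.id F) φ) + 2 ≤ finrank F V) :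
    ∃ a b, pairing (RingHom.id F) φ a v = 0 ∧ pairing (RingHom.id F) φ b v = 0 ∧
      pairing (RingHom.id F) φ a b ≠ 0 := by
  by_contra! hc
  have key : radical (RingHom.id F) φ ⊔ Submodule.span F {v} = ⊤ := by
    rw [eq_top_iff]
    intro y _
    rw [Submodule.mem_sup]
    set c := pairing (RingHom.id F) φ y v / pairing (RingHom.id F) φ v v with hcdef
    have hproj : ∀ x, pairing (RingHom.id F) φ
        (x + (-(pairing (RingHom.id F) φ x v / pairing (RingHom.id F) φ v v)) • v) v = 0 := by
      intro x
      rw [pairing_add_left, pairing_smul_left]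
      field_simp
      ring
    refine ⟨y + (-c) • v, ?_, c • v, Submodule.smul_mem _ _ (Submodule.mem_span_singleton_self v),
      by simp⟩
    rw [mem_radical]
    intro x
    have h1 := hc _ _ (hproj x) (hproj y)
    rw [← hcdef, pairing_add_left, pairing_smul_left, pairing_comm φ (y + -c • v) v, hproj y] at h1
    simpa using h1
  have h1 := Submodule.finrank_add_le_finrank_add_finrank (radical (RingHom.id F) φ)
    (Submodule.span F {v})
  have h2 : finrank F (Submodule.span F {v}) ≤ 1 := by
    simpa using finrank_span_le_card (R := F) ({v} : Set V)
  rw [key, finrank_top] at h1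
  omega

end Radical

/-! ### Vectors of norm -1. -/

section Vectors

variable {V : Type*} [AddCommGroup V] [Module F V] {n : ℕ} {φ : V →ₗ[F] (Fin n → F)}

theorem exists_pairing_self_ne_zero_of_two_ne_zero (h2 : (2 : F) ≠ 0) {a b : V}
    (hab : pairing (RingHom.id F) φ a b ≠ 0) :
    ∃ c ∈ Submodule.span F {a, b}, pairing (RingHom.id F) φ c c ≠ 0 := by
  by_contra! hc
  have ha := hc a (Submodule.subset_span (by simp))
  have hb := hc b (Submodule.subset_span (by simp))
  have hs := hc (a + b) (add_mem (Submodule.subset_span (by simp)) (Submodule.subset_span (by simp)))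
  simp only [pairing_add_left, pairing_add_right, ha, hb, pairing_comm φ a b] at hs
  apply mul_ne_zero h2 hab
  linear_combination hs

variable [FiniteDimensional F V]

/-- Rank at least 2 yields two orthogonal anisotropic vectors, and a binary form `α c² + β d²` with
`α, β ≠ 0` over a finite field of odd order takes every value. -/
theorem exists_pairing_self_eq_neg_one_of_odd [Finite F] (hF : ringChar F ≠ 2)
    (h : finrank F (radical (RingHom.id F) φ) + 2 ≤ finrank F V) :
    ∃ v, pairing (RingHom.id F) φ v v = -1 := by
  have h2 : (2 : F) ≠ 0 := Ring.two_ne_zero hF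
  obtain ⟨x, y, hxy⟩ := exists_pairing_ne_zero (σ := RingHom.id F) (φ := φ) (by omega)
  obtain ⟨u, -, hu⟩ := exists_pairing_self_ne_zero_of_two_ne_zero h2 hxy
  obtain ⟨a, b, ha, hb, hab⟩ := exists_pairing_ne_zero_of_orthogonal hu h
  obtain ⟨w, hw, hww⟩ := exists_pairing_self_ne_zero_of_two_ne_zero h2 hab
  have hwu : pairing (RingHom.id F) φ w u = 0 := by
    obtain ⟨c, d, rfl⟩ := Submodule.mem_span_pair.1 hw
    simp [pairing_add_left, pairing_smul_left, ha, hb]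
  have : Fintype F := Fintype.ofFinite F
  set α := pairing (RingHom.id F) φ u u
  set β := pairing (RingHom.id F) φ w w
  obtain ⟨c, d, hcd⟩ := FiniteField.exists_root_sum_quadratic
    (f := Polynomial.C α * Polynomial.X ^ 2 + Polynomial.C 0 * Polynomial.X + Polynomial.C 1)
    (g := Polynomial.C β * Polynomial.X ^ 2 + Polynomial.C 0 * Polynomial.X + Polynomial.C 0)
    (Polynomial.degree_quadratic hu) (Polynomial.degree_quadratic hww)
    (FiniteField.odd_card_of_char_ne_two hF)
  refine ⟨c • u + d • w, ?_⟩
  simp only [pairing_add_left, pairing_add_right, pairing_smul_left, pairing_smul_right, hwu,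
    pairing_comm φ w u]
  simp at hcd ⊢
  linear_combination hcd

/-- Every scalar is a square, so an anisotropic vector rescales to norm `1 = -1`. The vector `x`
guarantees that the form is still non-alternating after adjoining `v`: being orthogonal to `v`, it
keeps its norm. -/
theorem exists_pairing_self_eq_neg_one_of_even [Finite F] [CharP F 2]
    (h : finrank F (radical (RingHom.id F) φ) + 2 ≤ finrank F V)
    (hna : ∃ v, pairing (RingHom.id F) φ v v ≠ 0) :
    ∃ v x, pairing (RingHom.id F) φ v v = -1 ∧ pairing (RingHom.id F) φ x v = 0 ∧
      pairing (RingHom.id F) φ x x ≠ 0 := by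
  obtain ⟨u, hu⟩ := hna
  obtain ⟨c, hc⟩ : ∃ c : F, c * c = (pairing (RingHom.id F) φ u u)⁻¹ := by
    obtain ⟨c, hc⟩ := FiniteField.isSquare_of_char_two (ringChar.eq F 2)
      (pairing (RingHom.id F) φ u u)⁻¹
    exact ⟨c, hc.symm⟩
  have hv : pairing (RingHom.id F) φ (c • u) (c • u) = 1 := by
    rw [pairing_smul_left, pairing_smul_right, RingHom.id_apply, ← mul_assoc, hc,
      inv_mul_cancel₀ hu]
  set v := c • u
  have hneg : (-1 : F) = 1 := CharTwo.neg_eq 1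
  by_cases hx : ∃ x, pairing (RingHom.id F) φ x v = 0 ∧ pairing (RingHom.id F) φ x x ≠ 0
  · obtain ⟨x, hx⟩ := hx
    exact ⟨v, x, by rw [hv, hneg], hx⟩
  push Not at hx
  obtain ⟨a, b, ha, hb, hab⟩ :=
    exists_pairing_ne_zero_of_orthogonal (φ := φ) (v := v) (by simp [hv]) h
  have ha' := hx a ha
  have hb' := hx b hb
  set e := pairing (RingHom.id F) φ a b
  -- Here the complement of `v` is alternating. Tilting `v` by `a` keeps norm 1, and `b - e v` is
  -- orthogonal to the tilted vector with norm `e² ≠ 0`.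
  refine ⟨v + a, b + (-e) • v, ?_, ?_, ?_⟩ <;>
    simp only [pairing_add_left, pairing_add_right, pairing_smul_left, pairing_smul_right, ha, hb,
      hv, ha', hb', pairing_comm φ a v, pairing_comm φ b v, pairing_comm φ a b, hneg]
  · simp
  · simp [e]
  · simpa using hab

theorem exists_pairing_self_eq_neg_one_of_hermitian {σ : F →+* F} (hσ : ∀ x, σ (σ x) = x)
    (hne : ∃ x, σ x ≠ x) (hnorm : ∀ z, σ z = z → ∃ c, c * σ c = z)
    (h : finrank F (radical σ φ) < finrank F V) :
    ∃ v, pairing σ φ v v = -1 := by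
  obtain ⟨a, b, hab⟩ := exists_pairing_ne_zero h
  obtain ⟨u, hu⟩ : ∃ u, pairing σ φ u u ≠ 0 := by
    by_contra! hc
    -- If all norms vanished, scaling `b` so that its pairing with `a` becomes `d` would give `d + σ
    -- d = 0` for every `d`. Then `d = 1` forces characteristic 2, and so `σ` would be the identity.
    set e := pairing σ φ a b
    have key : ∀ d, d + σ d = 0 := by
      intro d
      have := hc (a + σ (d / e) • b)
      rw [pairing_add_left, pairing_add_right, pairing_add_right, pairing_smul_left,
        pairing_smul_left, pairing_smul_right, pairing_smul_right, hc a, hc b,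
        pairing_symm hσ a b, hσ] at this
      have h1 : d / e * e = d := div_mul_cancel₀ d hab
      have h2 : σ (d / e) * σ e = σ d := by rw [← map_mul, h1]
      linear_combination this - h1 - h2
    obtain ⟨x, hx⟩ := hne
    apply hx
    have h1 := key 1
    rw [map_one] at h1
    linear_combination key x - x * h1
  obtain ⟨c, hc⟩ := hnorm (-(pairing σ φ u u)⁻¹) (by
    rw [map_neg, map_inv₀, ← pairing_symm hσ])
  refine ⟨c • u, ?_⟩
  rw [pairing_smul_left, pairing_smul_right, ← mul_assoc, hc]
  field_simp

end Vectors

/-! ### The involution and the norm map of a field of square order. -/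

section Frobenius

theorem orderOf_generator {q : ℕ} (hF : Nat.card F = q ^ 2) {g : Fˣ}
    (hg : ∀ x, x ∈ Subgroup.zpowers g) : orderOf g = (q - 1) * (q + 1) := by
  rw [orderOf_eq_card_of_forall_mem_zpowers hg, Nat.card_units, hF]
  rw [mul_comm, ← Nat.sq_sub_sq, one_pow]

variable [Finite F] {p a : ℕ} [Fact p.Prime] [CharP F p]

theorem iterateFrobenius_involutive (hF : Nat.card F = (p ^ a) ^ 2) (x : F) :
    iterateFrobenius F p a (iterateFrobenius F p a x) = x := by
  have : Fintype F := Fintype.ofFinite F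
  rw [iterateFrobenius_def, iterateFrobenius_def, ← pow_mul, ← sq, ← hF, Nat.card_eq_fintype_card,
    FiniteField.pow_card]

theorem one_lt_of_card_eq_sq {q : ℕ} (hF : Nat.card F = q ^ 2) : 1 < q := by
  have := Finite.one_lt_card (α := F)
  rw [hF] at this
  by_contra! h
  have : q ^ 2 ≤ 1 := Nat.pow_le_one_iff (by norm_num) |>.2 h
  omega

theorem exists_iterateFrobenius_ne (hF : Nat.card F = (p ^ a) ^ 2) :
    ∃ x, iterateFrobenius F p a x ≠ x := by
  by_contra! hc
  obtain ⟨g, hg⟩ := IsCyclic.exists_generator (α := Fˣ)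
  have hq := one_lt_of_card_eq_sq hF
  have ho := orderOf_generator hF hg
  set q := p ^ a with hqdef
  have h1 : g ^ (q - 1) = 1 := by
    have h2 := hc g
    rw [iterateFrobenius_def, ← hqdef] at h2
    have h3 : g ^ (q - 1) * g = 1 * g := by
      rw [← pow_succ, Nat.sub_add_cancel hq.le, one_mul]
      exact Units.ext (by simpa using h2)
    exact mul_right_cancel h3
  have h4 := Nat.le_of_dvd (by omega) (orderOf_dvd_of_pow_eq_one h1)
  rw [ho] at h4
  nlinarith [Nat.sub_pos_of_lt hq]

/-- A nonzero fixed `z` is a power `g ^ j` of a generator of order `(q - 1)(q + 1)` with `z ^ (q -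
1) = 1`. Hence `q + 1` divides `j`, and `z` is a norm `c ^ (q + 1)`. -/
theorem exists_mul_iterateFrobenius_eq (hF : Nat.card F = (p ^ a) ^ 2) (z : F)
    (hz : iterateFrobenius F p a z = z) : ∃ c, c * iterateFrobenius F p a c = z := by
  rcases eq_or_ne z 0 with rfl | hz0
  · exact ⟨0, by simp⟩
  obtain ⟨g, hg⟩ := IsCyclic.exists_generator (α := Fˣ)
  have hq := one_lt_of_card_eq_sq hF
  have ho := orderOf_generator hF hg
  simp only [iterateFrobenius_def] at hz ⊢
  set q := p ^ a with hqdef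
  obtain ⟨j, hj⟩ := (mem_powers_iff_mem_zpowers).2 (hg (Units.mk0 z hz0))
  simp only at hj
  have h1 : g ^ (j * (q - 1)) = 1 := by
    rw [pow_mul, hj]
    have h3 : (Units.mk0 z hz0) ^ (q - 1) * Units.mk0 z hz0 = 1 * Units.mk0 z hz0 := by
      rw [← pow_succ, Nat.sub_add_cancel hq.le, one_mul]
      exact Units.ext (by simpa using hz)
    exact mul_right_cancel h3
  have h4 := orderOf_dvd_of_pow_eq_one h1
  rw [ho, mul_comm] at h4
  obtain ⟨i, rfl⟩ := Nat.dvd_of_mul_dvd_mul_right (Nat.sub_pos_of_lt hq) h4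
  refine ⟨((g ^ i : Fˣ) : F), ?_⟩
  rw [← pow_succ']
  have : z = ((Units.mk0 z hz0 : Fˣ) : F) := rfl
  rw [this, ← hj, ← Units.val_pow_eq_pow_val, ← pow_mul, mul_comm i]

end Frobenius

/-! ### From enlarged radicals to hull embeddings. -/

section Extension

variable {V : Type*} [AddCommGroup V] [Module F V] {σ : F →+* F} {n : ℕ}

/-- If every form that satisfies `P` and has a radical of dimension less than `t` represents `-1` by
some `v` whose adjunction preserves `P`, then the radical can be enlarged by one dimension per new
coordinate, up to dimension `t`. -/
theorem exists_extension [FiniteDimensional F V] (hσ : ∀ x, σ (σ x) = x) (t : ℕ)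
    (P : ∀ {k : ℕ}, (V →ₗ[F] (Fin k → F)) → Prop)
    (step : ∀ {k : ℕ} (φ : V →ₗ[F] (Fin k → F)), P φ → finrank F (radical σ φ) < t →
      ∃ v, pairing σ φ v v = -1 ∧ P (adjoin σ φ v))
    (φ : V →ₗ[F] (Fin n → F)) (hφ : P φ) :
    ∀ s, finrank F (radical σ φ) + s ≤ t →
      ∃ ψ : V →ₗ[F] (Fin (n + s) → F), (∀ x i, ψ x (Fin.castAdd s i) = φ x i) ∧
        finrank F (radical σ ψ) = finrank F (radical σ φ) + s ∧ P ψ := by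
  intro s
  induction s with
  | zero => exact fun _ => ⟨φ, fun _ _ => rfl, rfl, hφ⟩
  | succ s ih =>
    intro hs
    obtain ⟨ψ, hψ, hr, hP⟩ := ih (by omega)
    obtain ⟨v, hv, hPv⟩ := step ψ hP (by omega)
    refine ⟨adjoin σ ψ v, fun x i => ?_, ?_, hPv⟩
    · rw [← hψ x i]
      exact adjoin_castSucc (σ := σ) (φ := ψ) v x (Fin.castAdd s i)
    · rw [finrank_radical_adjoin hσ hv, hr, add_assoc]

theorem finrank_hull_range (ψ : V →ₗ[F] (Fin n → F)) (hψ : Function.Injective ψ) :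
    finrank F (hull σ (LinearMap.range ψ)) = finrank F (radical σ ψ) := by
  rw [hull, ← Submodule.map_comap_eq]
  exact (Submodule.equivMapOfInjective ψ hψ _).finrank_eq.symm

theorem isHullEmbedding_range {s : ℕ} (φ : V →ₗ[F] (Fin n → F)) (hφ : Function.Injective φ)
    (ψ : V →ₗ[F] (Fin (n + s) → F)) (h : ∀ x i, ψ x (Fin.castAdd s i) = φ x i) :
    IsHullEmbedding σ (finrank F (radical σ ψ)) (LinearMap.range φ) (LinearMap.range ψ) := by
  have hψ : Function.Injective ψ := by
    intro x y hxy
    apply hφ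
    ext i
    rw [← h, ← h, hxy]
  refine ⟨Nat.le_add_right _ _, ?_, finrank_hull_range ψ hψ, ?_⟩
  · rw [LinearMap.finrank_range_of_inj hψ, LinearMap.finrank_range_of_inj hφ]
  · have hc : (Finset.univ.map (Fin.castAddEmb (n := n) s)).card = n := by simp
    refine ⟨(Finset.univ.map (Fin.castAddEmb (n := n) s))ᶜ, by rw [compl_compl, hc], ?_⟩
    rw [← LinearMap.range_comp]
    congr 1
    ext x i
    simp only [LinearMap.coe_comp, Function.comp_apply, LinearMap.funLeft_apply]
    rw [← h]
    have := Finset.orderEmbOfFin_unique (s := (Finset.univ.map (Fin.castAddEmb (n := n) s))ᶜᶜ)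
      (k := n) (by rw [compl_compl, hc]) (f := Fin.castAdd s) (by simp)
      (Fin.strictMono_castAdd s)
    exact congrArg (ψ x) (congrFun this i).symm

end Extension

/-! ### Lower and upper bounds for the rank of `D₂`. -/

section Bounds

variable {σ : F →+* F} {t n s ℓ m : ℕ} {C : Submodule F (Fin n → F)}
  {C' : Submodule F (Fin (n + s) → F)} {H : Matrix (Fin ℓ) (Fin n) F}
  {D₁ : Matrix (Fin ℓ) (Fin s) F} {A : Matrix (Fin m) (Fin n) F} {D₂ : Matrix (Fin m) (Fin s) F}

theorem IsGeneratorMatrix.finrank_eq {ι : Type*} [Fintype ι] {G : Matrix ι (Fin n) F}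
    (h : IsGeneratorMatrix G C) : finrank F C = Fintype.card ι := by
  rw [← h.2, finrank_span_eq_card h.1]

theorem IsGeneratorMatrix.range_vecMulLinear {ι : Type*} [Fintype ι] {G : Matrix ι (Fin n) F}
    (h : IsGeneratorMatrix G C) : LinearMap.range G.vecMulLinear = C := by
  rw [_root_.range_vecMulLinear, h.2]

theorem IsGeneratorMatrix.vecMul_injective {ι : Type*} [Fintype ι] {G : Matrix ι (Fin n) F}
    (h : IsGeneratorMatrix G C) : Function.Injective G.vecMulLinear :=
  Matrix.vecMul_injective_iff.2 h.1

theorem vecMul_block_castAdd (x : Fin ℓ ⊕ Fin m → F) (i : Fin n) :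
    (x ᵥ* (fromBlocks H D₁ A D₂).submatrix id finSumFinEquiv.symm) (Fin.castAdd s i) =
      (x ᵥ* fromRows H A) i := by
  simp [vecMul, dotProduct, Fintype.sum_sum_type]

theorem vecMul_block_natAdd (x : Fin ℓ ⊕ Fin m → F) (i : Fin s) :
    (x ᵥ* (fromBlocks H D₁ A D₂).submatrix id finSumFinEquiv.symm) (Fin.natAdd n i) =
      ((x ∘ Sum.inl) ᵥ* D₁ + (x ∘ Sum.inr) ᵥ* D₂) i := by
  simp [vecMul, dotProduct, Fintype.sum_sum_type]

theorem IsBlockEmbedding.finrank_eq (h : IsBlockEmbedding σ t C C' H D₁ A D₂) :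
    finrank F C = ℓ + m := by
  simpa using h.code_generator.finrank_eq

/-- The coefficient vector `x` of a hull word of `C'` is sent to its `H`-part and to its `A`-part
times `D₂`. If both vanish, the new coordinates contribute nothing, so the word of `C` lies in
`Hull(C)`, the span of `H`; its `A`-part is then 0 as well. -/
theorem IsBlockEmbedding.le_add_rank (h : IsBlockEmbedding σ t C C' H D₁ A D₂) :
    t ≤ ℓ + D₂.rank := by
  set L := ((fromBlocks H D₁ A D₂).submatrix id finSumFinEquiv.symm).vecMulLinear with hL
  have hrange : LinearMap.range L = C' := h.embedding_generator.range_vecMulLinear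
  have ht : finrank F (radical σ L) = t := by
    rw [← h.shortest.1.finrank_hull, ← hrange,
      finrank_hull_range L h.embedding_generator.vecMul_injective]
  let T : (Fin ℓ ⊕ Fin m → F) →ₗ[F] (Fin ℓ → F) × LinearMap.range D₂.vecMulLinear :=
    (LinearMap.funLeft F F Sum.inl).prod (D₂.vecMulLinear.rangeRestrict ∘ₗ
      LinearMap.funLeft F F Sum.inr)
  have hT : Function.Injective (T ∘ₗ (radical σ L).subtype) := by
    rw [← LinearMap.ker_eq_bot, LinearMap.ker_eq_bot']
    rintro ⟨x, hx⟩ hx0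
    have h1 : x ∘ Sum.inl = 0 := congrArg Prod.fst hx0
    have h2 : (x ∘ Sum.inr) ᵥ* D₂ = 0 := congrArg Subtype.val (congrArg Prod.snd hx0)
    have hxA : x ᵥ* fromRows H A ∈ hull σ C := by
      refine ⟨?_, fun u hu => ?_⟩
      · rw [← h.code_generator.range_vecMulLinear]
        exact ⟨x, rfl⟩
      · rw [← h.code_generator.range_vecMulLinear] at hu
        obtain ⟨y, rfl⟩ := hu
        have := mem_radical.1 hx y
        rw [pairing, Fin.sum_univ_add] at this
        simpa only [hL, vecMulLinear_apply, vecMul_block_castAdd, vecMul_block_natAdd, h1, h2,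
          zero_vecMul, add_zero, Pi.zero_apply, map_zero, mul_zero, Finset.sum_const_zero] using this
    rw [← h.hull_generator.range_vecMulLinear] at hxA
    obtain ⟨z, hz⟩ := hxA
    have hxz : x = Sum.elim z 0 := by
      apply h.code_generator.vecMul_injective
      simp only [vecMulLinear_apply] at hz ⊢
      rw [← hz]
      ext i
      simp [vecMul, dotProduct, Fintype.sum_sum_type]
    ext i
    rcases i with i | i
    · exact congrFun h1 i
    · simp [hxz]
  have := LinearMap.finrank_le_finrank_of_injective hT
  rw [ht, finrank_prod, finrank_fin_fun, _root_.range_vecMulLinear,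
    ← rank_eq_finrank_span_row] at this
  exact this

/-- The number of new coordinates of a shortest embedding bounds the rank from above. -/
theorem IsBlockEmbedding.rank_le (h : IsBlockEmbedding σ t C C' H D₁ A D₂) {s' : ℕ}
    (hex : t < finrank F C → finrank F (radical σ C.subtype) = ℓ →
      ∃ ψ : C →ₗ[F] (Fin (n + s') → F), (∀ x i, ψ x (Fin.castAdd s' i) = C.subtype x i) ∧
        finrank F (radical σ ψ) = t) :
    D₂.rank ≤ max s' (t - ℓ) := by
  have hk := h.finrank_eq
  have htk := h.le_finrank
  rcases htk.lt_or_eq with hlt | heq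
  · have hr : finrank F (radical σ C.subtype) = ℓ := by
      rw [← finrank_hull_range _ C.injective_subtype, C.range_subtype, h.finrank_hull]
    obtain ⟨ψ, hψ, hrad⟩ := hex hlt hr
    have he := isHullEmbedding_range (σ := σ) C.subtype C.injective_subtype ψ hψ
    rw [C.range_subtype, hrad] at he
    have := h.shortest.2 _ _ he
    have hw := D₂.rank_le_width
    omega
  -- For `t = dim C` the height of `D₂` is `m = t - ℓ`; no embedding needs to be constructed.
  · have := D₂.rank_le_height
    omega

end Bounds

/-! ### Short embeddings for each kind of form. -/

section Existence

variable {V : Type*} [AddCommGroup V] [Module F V] {t n s : ℕ}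

theorem exists_extension_cast {σ : F →+* F} {N : ℕ} (h : N = n + s) (φ : V →ₗ[F] (Fin n → F))
    (ψ : V →ₗ[F] (Fin N → F)) (hψ : ∀ x i, ψ x (Fin.cast h.symm (Fin.castAdd s i)) = φ x i) :
    ∃ ψ' : V →ₗ[F] (Fin (n + s) → F),
      (∀ x i, ψ' x (Fin.castAdd s i) = φ x i) ∧
        finrank F (radical σ ψ') = finrank F (radical σ ψ) := by
  subst h
  exact ⟨ψ, hψ, rfl⟩

variable [FiniteDimensional F V]

theorem exists_extension_hermitian {σ : F →+* F} (hσ : ∀ x, σ (σ x) = x)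
    (hne : ∃ x, σ x ≠ x) (hnorm : ∀ z, σ z = z → ∃ c, c * σ c = z)
    (φ : V →ₗ[F] (Fin n → F)) (ht : t < finrank F V) (hr : finrank F (radical σ φ) + s = t) :
    ∃ ψ : V →ₗ[F] (Fin (n + s) → F),
      (∀ x i, ψ x (Fin.castAdd s i) = φ x i) ∧ finrank F (radical σ ψ) = t := by
  obtain ⟨ψ, h1, h2, -⟩ := exists_extension hσ t (fun _ => True) (fun φ _ hφ => by
    obtain ⟨v, hv⟩ := exists_pairing_self_eq_neg_one_of_hermitian (φ := φ) hσ hne hnorm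
      (hφ.trans ht)
    exact ⟨v, hv, trivial⟩) φ trivial s hr.le
  exact ⟨ψ, h1, h2.trans hr⟩

variable [Finite F]

theorem exists_extension_odd (hF : ringChar F ≠ 2) (φ : V →ₗ[F] (Fin n → F))
    (ht : t < finrank F V) (hr : finrank F (radical (RingHom.id F) φ) + s = t) :
    ∃ ψ : V →ₗ[F] (Fin (n + s) → F),
      (∀ x i, ψ x (Fin.castAdd s i) = φ x i) ∧ finrank F (radical (RingHom.id F) ψ) = t := by
  obtain ⟨ψ, h1, h2, -⟩ := exists_extension (σ := RingHom.id F) (fun _ => rfl) t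
    (fun _ => True) (fun φ _ hφ => by
      obtain ⟨v, hv⟩ := exists_pairing_self_eq_neg_one_of_odd (φ := φ) hF (by omega)
      exact ⟨v, hv, trivial⟩) φ trivial s hr.le
  exact ⟨ψ, h1, h2.trans hr⟩

theorem exists_extension_nonalternating [CharP F 2] (φ : V →ₗ[F] (Fin n → F))
    (hna : ∃ v, pairing (RingHom.id F) φ v v ≠ 0)
    (ht : t < finrank F V) (hr : finrank F (radical (RingHom.id F) φ) + s = t) :
    ∃ ψ : V →ₗ[F] (Fin (n + s) → F),
      (∀ x i, ψ x (Fin.castAdd s i) = φ x i) ∧ finrank F (radical (RingHom.id F) ψ) = t := by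
  obtain ⟨ψ, h1, h2, -⟩ := exists_extension (σ := RingHom.id F) (fun _ => rfl) t
    (fun φ => ∃ v, pairing (RingHom.id F) φ v v ≠ 0) (fun φ hna hφ => by
      obtain ⟨v, x, hv, hxv, hxx⟩ :=
        exists_pairing_self_eq_neg_one_of_even (φ := φ) (by omega) hna
      refine ⟨v, hv, x, ?_⟩
      rw [pairing_adjoin, hxv, zero_mul, add_zero]
      exact hxx) φ hna s hr.le
  exact ⟨ψ, h1, h2.trans hr⟩

/-- A non-radical `w` is isotropic, so adjoining it preserves the radical; any `x` with `⟨x, w⟩ ≠ 0`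
acquires norm `⟨x, w⟩²`, and the non-alternating case applies. -/
theorem exists_extension_alternating [CharP F 2] (φ : V →ₗ[F] (Fin n → F))
    (halt : ∀ v, pairing (RingHom.id F) φ v v = 0)
    (ht : t < finrank F V) (hr : finrank F (radical (RingHom.id F) φ) + s = t) :
    ∃ ψ : V →ₗ[F] (Fin (n + (s + 1)) → F),
      (∀ x i, ψ x (Fin.castAdd (s + 1) i) = φ x i) ∧
        finrank F (radical (RingHom.id F) ψ) = t := by
  obtain ⟨x, w, hxw⟩ := exists_pairing_ne_zero (σ := RingHom.id F) (φ := φ) (by omega)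
  have hrad := radical_adjoin_of_isotropic (σ := RingHom.id F) (fun _ => rfl) (halt w)
  obtain ⟨ψ, h1, h2⟩ := exists_extension_nonalternating (s := s) (adjoin (RingHom.id F) φ w)
    ⟨x, by rw [pairing_adjoin, halt, zero_add]; exact mul_ne_zero hxw hxw⟩ ht (by rwa [hrad])
  obtain ⟨ψ', h1', h2'⟩ := exists_extension_cast (σ := RingHom.id F) (s := s + 1) (by omega) φ ψ
    (fun x i => by rw [← adjoin_castSucc w x i, ← h1]; rfl)
  exact ⟨ψ', h1', h2'.trans h2⟩

end Existence

/-! ### The rank for each type of code. -/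

section Main

variable {t n s ℓ m : ℕ} {C : Submodule F (Fin n → F)}
  {C' : Submodule F (Fin (n + s) → F)} {H : Matrix (Fin ℓ) (Fin n) F}
  {D₁ : Matrix (Fin ℓ) (Fin s) F} {A : Matrix (Fin m) (Fin n) F} {D₂ : Matrix (Fin m) (Fin s) F}

theorem IsTypeEvenNonalternating.exists_pairing_ne_zero (hC : IsTypeEvenNonalternating C) :
    ∃ v, pairing (RingHom.id F) C.subtype v v ≠ 0 := by
  obtain ⟨h2, k, G, hG, hna⟩ := hC
  have : CharP F 2 := ringChar.of_eq h2
  by_contra! hc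
  refine hna ⟨fun i => ?_, fun i j => ?_⟩
  · have hi : G i ∈ C := by
      rw [← hG.2]
      exact Submodule.subset_span ⟨i, rfl⟩
    exact hc ⟨G i, hi⟩
  · rw [CharTwo.neg_eq, mul_apply, mul_apply]
    exact Finset.sum_congr rfl fun _ _ => mul_comm _ _

/-- In characteristic 2 squaring is additive, so vanishing of the norm on generators passes to the
span. -/
theorem sum_sq_eq_zero_of_alternating (hC : IsTypeEvenAlternating C) {v : Fin n → F}
    (hv : v ∈ C) : ∑ i, v i * v i = 0 := by
  obtain ⟨h2, k, G, hG, halt, -⟩ := hC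
  have : CharP F 2 := ringChar.of_eq h2
  rw [← hG.2] at hv
  induction hv using Submodule.span_induction with
  | mem x hx =>
    obtain ⟨i, rfl⟩ := hx
    exact halt i
  | zero => simp
  | add x y _ _ hx hy =>
    have : ∀ i, (x + y) i * (x + y) i = x i * x i + y i * y i := fun i => by
      rw [Pi.add_apply, CharTwo.add_mul_self]
    rw [Finset.sum_congr rfl fun i _ => this i, Finset.sum_add_distrib, hx, hy, add_zero]
  | smul c x _ hx =>
    have : ∀ i, (c • x) i * (c • x) i = c * c * (x i * x i) := fun i => by
      rw [Pi.smul_apply, smul_eq_mul]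
      ring
    rw [Finset.sum_congr rfl fun i _ => this i, ← Finset.mul_sum, hx, mul_zero]

variable [Finite F]

theorem rank_eq_of_hermitian {p a : ℕ} [Fact p.Prime] [CharP F p] (hF : Nat.card F = (p ^ a) ^ 2)
    (h : IsBlockEmbedding (iterateFrobenius F p a) t C C' H D₁ A D₂) : D₂.rank = t - ℓ := by
  have h1 := h.le_add_rank
  have hlt := h.hull_lt
  have h2 := h.rank_le (s' := t - ℓ) fun ht hr =>
    exists_extension_hermitian (iterateFrobenius_involutive hF) (exists_iterateFrobenius_ne hF)
      (exists_mul_iterateFrobenius_eq hF) _ ht (by omega)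
  omega

theorem rank_eq_of_odd (hF : ringChar F ≠ 2)
    (h : IsBlockEmbedding (RingHom.id F) t C C' H D₁ A D₂) : D₂.rank = t - ℓ := by
  have h1 := h.le_add_rank
  have hlt := h.hull_lt
  have h2 := h.rank_le (s' := t - ℓ) fun ht hr => exists_extension_odd hF _ ht (by omega)
  omega

theorem rank_eq_of_nonalternating (hC : IsTypeEvenNonalternating C)
    (h : IsBlockEmbedding (RingHom.id F) t C C' H D₁ A D₂) : D₂.rank = t - ℓ := by
  have : CharP F 2 := ringChar.of_eq hC.1
  have h1 := h.le_add_rank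
  have hlt := h.hull_lt
  have h2 := h.rank_le (s' := t - ℓ) fun ht hr =>
    exists_extension_nonalternating _ hC.exists_pairing_ne_zero ht (by omega)
  omega

theorem rank_of_alternating (hC : IsTypeEvenAlternating C)
    (h : IsBlockEmbedding (RingHom.id F) t C C' H D₁ A D₂) :
    D₂.rank = t - ℓ ∨ D₂.rank = t - ℓ + 1 := by
  have : CharP F 2 := ringChar.of_eq hC.1
  have h1 := h.le_add_rank
  have hlt := h.hull_lt
  have h2 := h.rank_le (s' := t - ℓ + 1) fun ht hr =>
    exists_extension_alternating _ (fun v => sum_sq_eq_zero_of_alternating hC v.2) ht (by omega)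
  omega

end Main

/-! ### Lower bounds for the length of embeddings of alternating codes with trivial hull. -/

section Length

variable {t n n' : ℕ} {C : Submodule F (Fin n → F)} {C' : Submodule F (Fin n' → F)}

theorem sum_eq_sum_orderEmbOfFin_add {S : Finset (Fin n')} (h : Sᶜ.card = n) (f : Fin n' → F) :
    ∑ i, f i = ∑ j, f (Sᶜ.orderEmbOfFin h j) + ∑ i ∈ S, f i := by
  rw [← Finset.sum_compl_add_sum S f]
  congr 1
  rw [← Finset.sum_coe_sort Sᶜ f, ← (Sᶜ.orderIsoOfFin h).toEquiv.sum_comp]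
  rfl

/-- The codeword `x` of the hull of `C'` vanishes as soon as its deleted part is orthogonal to the
deleted parts of all codewords. -/
theorem eq_zero_of_sum_mul_eq_zero {S : Finset (Fin n')} (h : Sᶜ.card = n)
    (hS : C'.map (LinearMap.funLeft F F (Sᶜ.orderEmbOfFin h)) = C)
    (hfin : finrank F C' = finrank F C) (hC : hull (RingHom.id F) C = ⊥) {x : Fin n' → F}
    (hx : x ∈ hull (RingHom.id F) C') (hxS : ∀ y ∈ C', ∑ i ∈ S, y i * x i = 0) : x = 0 := by
  set π := LinearMap.funLeft F F (Sᶜ.orderEmbOfFin h)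
  have hinj : Function.Injective (π.domRestrict C') := by
    rw [← LinearMap.ker_eq_bot]
    have h1 := LinearMap.finrank_range_add_finrank_ker (π.domRestrict C')
    rw [LinearMap.range_domRestrict, hS, hfin] at h1
    exact Submodule.finrank_eq_zero.1 (by omega)
  have hπ : π x ∈ hull (RingHom.id F) C := by
    refine ⟨hS ▸ ⟨x, hx.1, rfl⟩, fun u hu => ?_⟩
    rw [← hS] at hu
    obtain ⟨y, hy, rfl⟩ := hu
    have h1 := hx.2 y hy
    rw [sum_eq_sum_orderEmbOfFin_add h] at h1
    simp only [RingHom.id_apply] at h1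
    rw [hxS y hy, add_zero] at h1
    exact h1
  rw [hC, Submodule.mem_bot] at hπ
  have : (⟨x, hx.1⟩ : C') = 0 := hinj (by simpa using hπ)
  exact congrArg Subtype.val this

variable [CharP F 2]

/-- The kept part of `x` has norm 0, so the deleted part has too, and in characteristic 2 its norm
is the square of its coordinate sum. -/
theorem sum_eq_zero_of_isotropic {S : Finset (Fin n')} (h : Sᶜ.card = n)
    (hC : ∀ v ∈ C, ∑ i, v i * v i = 0) {x : Fin n' → F}
    (hx : x ∘ Sᶜ.orderEmbOfFin h ∈ C) (hxx : ∑ i, x i * x i = 0) : ∑ i ∈ S, x i = 0 := by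
  rw [sum_eq_sum_orderEmbOfFin_add h] at hxx
  have h1 := hC _ hx
  simp only [Function.comp_apply] at h1
  rw [h1, zero_add] at hxx
  have h2 : (∑ i ∈ S, x i) ^ 2 = 0 := by
    rw [CharTwo.sum_sq, ← hxx]
    exact Finset.sum_congr rfl fun i _ => sq _
  exact pow_eq_zero_iff (two_ne_zero) |>.1 h2

/-- With at most one deleted coordinate, each hull word is 0 there, so it is 0 altogether and the
hull is trivial. -/
theorem length_ge_add_two (hC : ∀ v ∈ C, ∑ i, v i * v i = 0)
    (hhull : hull (RingHom.id F) C = ⊥) (ht : 0 < t)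
    (h : IsHullEmbedding (RingHom.id F) t C C') : n + 2 ≤ n' := by
  obtain ⟨-, hfin, hrk, S, hS, hmap⟩ := h
  by_contra! hlt
  have hcard : S.card ≤ 1 := by
    rw [Finset.card_compl, Fintype.card_fin] at hS
    have := S.card_le_univ
    rw [Fintype.card_fin] at this
    omega
  have hbot : hull (RingHom.id F) C' = ⊥ := by
    rw [Submodule.eq_bot_iff]
    intro x hx
    refine eq_zero_of_sum_mul_eq_zero hS hmap hfin hhull hx fun y _ =>
      Finset.sum_eq_zero fun i hi => ?_
    have h1 := sum_eq_zero_of_isotropic hS hC (hmap ▸ ⟨x, hx.1, rfl⟩) (hx.2 x hx.1)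
    have hSi : S = {i} :=
      Finset.eq_singleton_iff_unique_mem.2 ⟨hi, fun j hj => Finset.card_le_one.1 hcard j hj i hi⟩
    rw [hSi, Finset.sum_singleton] at h1
    rw [h1, mul_zero]
  rw [hbot, finrank_bot] at hrk
  omega

/-- Here `C'` is self-orthogonal, so the deleted entries of every codeword sum to 0. If there are
two, they are equal, and any two deleted parts are orthogonal because `2 = 0`; again the hull would
be trivial. -/
theorem length_ge_add_three (hC : ∀ v ∈ C, ∑ i, v i * v i = 0)
    (hhull : hull (RingHom.id F) C = ⊥) (hpos : 0 < finrank F C)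
    (h : IsHullEmbedding (RingHom.id F) (finrank F C) C C') : n + 3 ≤ n' := by
  obtain ⟨-, hfin, hrk, S, hS, hmap⟩ := h
  by_contra! hlt
  have hcard : S.card ≤ 2 := by
    rw [Finset.card_compl, Fintype.card_fin] at hS
    have := S.card_le_univ
    rw [Fintype.card_fin] at this
    omega
  have heq : hull (RingHom.id F) C' = C' :=
    Submodule.eq_of_le_of_finrank_eq inf_le_left (hrk.trans hfin.symm)
  have hsum : ∀ x ∈ C', ∑ i ∈ S, x i = 0 := fun x hx =>
    sum_eq_zero_of_isotropic hS hC (hmap ▸ ⟨x, hx, rfl⟩) ((heq ▸ hx : x ∈ hull _ C').2 x hx)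
  have hbot : hull (RingHom.id F) C' = ⊥ := by
    rw [Submodule.eq_bot_iff]
    intro x hx
    refine eq_zero_of_sum_mul_eq_zero hS hmap hfin hhull hx fun y hy => ?_
    have hx1 := hsum x hx.1
    have hy1 := hsum y hy
    interval_cases hc : S.card
    · rw [Finset.card_eq_zero.1 hc, Finset.sum_empty]
    · obtain ⟨i, rfl⟩ := Finset.card_eq_one.1 hc
      rw [Finset.sum_singleton] at hx1 ⊢
      rw [hx1, mul_zero]
    · obtain ⟨i, j, hij, rfl⟩ := Finset.card_eq_two.1 hc
      rw [Finset.sum_pair hij] at hx1 hy1 ⊢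
      rw [CharTwo.add_eq_zero.1 hx1, CharTwo.add_eq_zero.1 hy1, CharTwo.add_self_eq_zero]
  rw [hbot, finrank_bot] at hrk
  omega

end Length

/-! ### The even weight code of length 3 attains both ranks. -/

section Examples

theorem isGeneratorMatrix_range {ι : Type*} [Fintype ι] {n : ℕ} {G : Matrix ι (Fin n) F}
    (h : Function.Injective G.vecMulLinear) :
    IsGeneratorMatrix G (LinearMap.range G.vecMulLinear) :=
  ⟨Matrix.vecMul_injective_iff.1 h, (_root_.range_vecMulLinear G).symm⟩

/-- A block embedding of a code with trivial hull. -/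
theorem isBlockEmbedding_of_hull_eq_bot {n s m : ℕ} {t : ℕ} (H : Matrix (Fin 0) (Fin n) F)
    (D₁ : Matrix (Fin 0) (Fin s) F) (A : Matrix (Fin m) (Fin n) F) (D₂ : Matrix (Fin m) (Fin s) F)
    (hinj : Function.Injective (fromRows H A).vecMulLinear)
    (hhull : hull (RingHom.id F) (LinearMap.range (fromRows H A).vecMulLinear) = ⊥)
    (ht : 0 < t) (htm : t ≤ m)
    (hrad : finrank F (radical (RingHom.id F)
      ((fromBlocks H D₁ A D₂).submatrix id finSumFinEquiv.symm).vecMulLinear) = t)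
    (hmin : ∀ (k : ℕ) (C'' : Submodule F (Fin k → F)), IsHullEmbedding (RingHom.id F) t
      (LinearMap.range (fromRows H A).vecMulLinear) C'' → n + s ≤ k) :
    IsBlockEmbedding (RingHom.id F) t (LinearMap.range (fromRows H A).vecMulLinear)
      (LinearMap.range ((fromBlocks H D₁ A D₂).submatrix id finSumFinEquiv.symm).vecMulLinear)
      H D₁ A D₂ where
  finrank_hull := by rw [hhull, finrank_bot]
  hull_lt := ht
  le_finrank := by
    rw [LinearMap.finrank_range_of_inj hinj]
    simpa using htm
  shortest := by
    refine ⟨?_, hmin⟩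
    have := isHullEmbedding_range (σ := RingHom.id F) _ hinj
      ((fromBlocks H D₁ A D₂).submatrix id finSumFinEquiv.symm).vecMulLinear
      (fun x i => vecMul_block_castAdd x i)
    rwa [hrad] at this
  hull_generator := by
    refine ⟨linearIndependent_empty_type, ?_⟩
    rw [hhull, Set.range_eq_empty, Submodule.span_empty]
  code_generator := isGeneratorMatrix_range hinj
  embedding_generator := by
    refine isGeneratorMatrix_range fun x y hxy => hinj ?_
    ext i
    have := congrFun hxy (Fin.castAdd s i)
    simpa only [vecMulLinear_apply, vecMul_block_castAdd] using this

/-- A generator matrix of the even weight code of length three. -/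
def evenWeightMatrix (F : Type*) [Field F] : Matrix (Fin 2) (Fin 3) F := !![1, 1, 0; 0, 1, 1]

/-- The embedding of `F²` onto the even weight code of length three. -/
abbrev evenWeightMap (F : Type*) [Field F] : (Fin 0 ⊕ Fin 2 → F) →ₗ[F] (Fin 3 → F) :=
  (fromRows (0 : Matrix (Fin 0) (Fin 3) F) (evenWeightMatrix F)).vecMulLinear

theorem evenWeightMap_apply (x : Fin 0 ⊕ Fin 2 → F) :
    evenWeightMap F x = ![x (.inr 0), x (.inr 0) + x (.inr 1), x (.inr 1)] := by
  ext i
  fin_cases i <;> simp [evenWeightMatrix, vecMul, dotProduct]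

theorem evenWeightMap_injective : Function.Injective (evenWeightMap F) := by
  intro x y h
  rw [evenWeightMap_apply, evenWeightMap_apply] at h
  ext i
  rcases i with i | i
  · exact i.elim0
  · fin_cases i
    · simpa using congrFun h 0
    · simpa using congrFun h 2

theorem pairing_evenWeightMap [CharP F 2] (x y : Fin 0 ⊕ Fin 2 → F) :
    pairing (RingHom.id F) (evenWeightMap F) x y =
      x (.inr 0) * y (.inr 1) + x (.inr 1) * y (.inr 0) := by
  simp only [pairing, evenWeightMap_apply, Fin.sum_univ_three]
  simp
  linear_combination (x (.inr 0) * y (.inr 0) + x (.inr 1) * y (.inr 1)) * CharTwo.two_eq_zero (R := F)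

theorem isTypeEvenAlternating_evenWeight (h2 : ringChar F = 2) :
    IsTypeEvenAlternating (LinearMap.range (evenWeightMap F)) := by
  have : CharP F 2 := ringChar.of_eq h2
  refine ⟨h2, 2, evenWeightMatrix F, ⟨?_, ?_⟩, ?_, ?_⟩
  · exact (Matrix.vecMul_injective_iff.1 (evenWeightMap_injective (F := F))).comp Sum.inr
      Sum.inr_injective
  · rw [_root_.range_vecMulLinear]
    congr 1
    ext v
    constructor
    · rintro ⟨i, rfl⟩
      exact ⟨.inr i, rfl⟩
    · rintro ⟨i | i, rfl⟩
      · exact i.elim0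
      · exact ⟨i, rfl⟩
  · intro i
    fin_cases i <;> simp [evenWeightMatrix, mul_apply, Fin.sum_univ_three, CharTwo.add_self_eq_zero]
  · intro i j
    fin_cases i <;> fin_cases j <;>
      simp [evenWeightMatrix, mul_apply, Fin.sum_univ_three, CharTwo.add_self_eq_zero,
        CharTwo.neg_eq]

theorem hull_evenWeight [CharP F 2] :
    hull (RingHom.id F) (LinearMap.range (evenWeightMap F)) = ⊥ := by
  apply Submodule.finrank_eq_zero.1
  rw [finrank_hull_range _ evenWeightMap_injective, Submodule.finrank_eq_zero,
    Submodule.eq_bot_iff]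
  intro y hy
  simp only [mem_radical, pairing_evenWeightMap] at hy
  ext i
  rcases i with i | i
  · exact i.elim0
  · fin_cases i
    · simpa using hy (Pi.single (.inr 1) 1)
    · simpa using hy (Pi.single (.inr 0) 1)

theorem pairing_block {n s m : ℕ} (H : Matrix (Fin 0) (Fin n) F)
    (D₁ : Matrix (Fin 0) (Fin s) F) (A : Matrix (Fin m) (Fin n) F) (D₂ : Matrix (Fin m) (Fin s) F)
    (x y : Fin 0 ⊕ Fin m → F) :
    pairing (RingHom.id F)
      ((fromBlocks H D₁ A D₂).submatrix id finSumFinEquiv.symm).vecMulLinear x y =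
    pairing (RingHom.id F) (fromRows H A).vecMulLinear x y +
      ∑ i, ((x ∘ Sum.inr) ᵥ* D₂) i * ((y ∘ Sum.inr) ᵥ* D₂) i := by
  rw [pairing, Fin.sum_univ_add]
  simp only [vecMulLinear_apply, vecMul_block_castAdd, vecMul_block_natAdd, pairing]
  simp

theorem rank_evenWeightMatrix : (evenWeightMatrix F).rank = 2 := by
  rw [LinearIndependent.rank_matrix, Fintype.card_fin]
  exact (Matrix.vecMul_injective_iff.1 (evenWeightMap_injective (F := F))).comp Sum.inr
      Sum.inr_injective

/-- Repeating the generator matrix doubles the form, hence kills it, giving `t = 2`. Three new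
coordinates are necessary, yet the repeated block has rank only 2. -/
theorem exists_rank_eq (h2 : ringChar F = 2) :
    ∃ (t n s ℓ m : ℕ) (C : Submodule F (Fin n → F)) (C' : Submodule F (Fin (n + s) → F))
      (H : Matrix (Fin ℓ) (Fin n) F) (D₁ : Matrix (Fin ℓ) (Fin s) F)
      (A : Matrix (Fin m) (Fin n) F) (D₂ : Matrix (Fin m) (Fin s) F),
      IsBlockEmbedding (RingHom.id F) t C C' H D₁ A D₂ ∧ IsTypeEvenAlternating C ∧
        D₂.rank = t - ℓ := by
  have : CharP F 2 := ringChar.of_eq h2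
  have hfin : finrank F (LinearMap.range (evenWeightMap F)) = 2 := by
    rw [LinearMap.finrank_range_of_inj evenWeightMap_injective]
    simp
  refine ⟨2, 3, 3, 0, 2, _, _, 0, 0, evenWeightMatrix F, evenWeightMatrix F,
    isBlockEmbedding_of_hull_eq_bot _ _ _ _ evenWeightMap_injective hull_evenWeight two_pos le_rfl
      ?_ ?_, isTypeEvenAlternating_evenWeight h2, rank_evenWeightMatrix⟩
  · have : radical (RingHom.id F) ((fromBlocks (0 : Matrix (Fin 0) (Fin 3) F) 0
        (evenWeightMatrix F) (evenWeightMatrix F)).submatrix id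
          finSumFinEquiv.symm).vecMulLinear = ⊤ := by
      rw [eq_top_iff]
      intro y _
      rw [mem_radical]
      intro x
      rw [pairing_block, ← CharTwo.add_self_eq_zero (pairing (RingHom.id F) (evenWeightMap F) x y)]
      congr 1
    rw [this, finrank_top]
    simp
  · intro k C'' h
    refine length_ge_add_three
      (fun v hv => sum_sq_eq_zero_of_alternating (isTypeEvenAlternating_evenWeight h2) hv)
      hull_evenWeight (by rw [hfin]; norm_num) (by rwa [hfin])

/-- For `t = 1` two new coordinates are needed. The Gram matrix of the rows of `!![1, 1; 1, 0]` is
`!![0, 1; 1, 1]`; added to the hyperbolic plane it leaves `diag(0, 1)`, with a one-dimensional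
radical, while the block is invertible. -/
theorem exists_rank_eq_add_one (h2 : ringChar F = 2) :
    ∃ (t n s ℓ m : ℕ) (C : Submodule F (Fin n → F)) (C' : Submodule F (Fin (n + s) → F))
      (H : Matrix (Fin ℓ) (Fin n) F) (D₁ : Matrix (Fin ℓ) (Fin s) F)
      (A : Matrix (Fin m) (Fin n) F) (D₂ : Matrix (Fin m) (Fin s) F),
      IsBlockEmbedding (RingHom.id F) t C C' H D₁ A D₂ ∧ IsTypeEvenAlternating C ∧
        D₂.rank = t - ℓ + 1 := by
  have : CharP F 2 := ringChar.of_eq h2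
  refine ⟨1, 3, 2, 0, 2, _, _, 0, 0, evenWeightMatrix F, !![1, 1; 1, 0],
    isBlockEmbedding_of_hull_eq_bot _ _ _ _ evenWeightMap_injective hull_evenWeight one_pos
      one_le_two ?_ ?_, isTypeEvenAlternating_evenWeight h2, ?_⟩
  · have hp : ∀ x y, pairing (RingHom.id F) ((fromBlocks (0 : Matrix (Fin 0) (Fin 3) F) 0
        (evenWeightMatrix F) !![1, 1; 1, 0]).submatrix id
          finSumFinEquiv.symm).vecMulLinear x y = x (.inr 1) * y (.inr 1) := by
      intro x y
      rw [pairing_block, pairing_evenWeightMap]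
      simp [vecMul, dotProduct]
      linear_combination (x (.inr 0) * y (.inr 0) + x (.inr 0) * y (.inr 1) +
        x (.inr 1) * y (.inr 0)) * CharTwo.two_eq_zero (R := F)
    have : radical (RingHom.id F) ((fromBlocks (0 : Matrix (Fin 0) (Fin 3) F) 0
        (evenWeightMatrix F) !![1, 1; 1, 0]).submatrix id
          finSumFinEquiv.symm).vecMulLinear = Submodule.span F {Pi.single (.inr 0) 1} := by
      ext y
      rw [mem_radical, Submodule.mem_span_singleton]
      simp only [hp]
      constructor
      · intro h
        refine ⟨y (.inr 0), ?_⟩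
        ext i
        rcases i with i | i
        · exact i.elim0
        · fin_cases i
          · simp
          · simpa using (h (Pi.single (.inr 1) 1)).symm
      · rintro ⟨c, rfl⟩ x
        simp
    rw [this]
    exact finrank_span_singleton (by simp)
  · intro k C'' h
    exact length_ge_add_two
      (fun v hv => sum_sq_eq_zero_of_alternating (isTypeEvenAlternating_evenWeight h2) hv)
      hull_evenWeight one_pos h
  · rw [rank_of_isUnit _ ((isUnit_iff_isUnit_det _).2 (by simp [det_fin_two]))]
    simp

end Examples

end HullEmbedding

open HullEmbedding in
theorem mainTheorem5 {F : Type*} [Field F] [Finite F] :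
    -- Hermitian case
    (∀ (p a : ℕ) [Fact p.Prime] [CharP F p], Nat.card F = (p ^ a) ^ 2 →
      ∀ (t n s ℓ m : ℕ) (C : Submodule F (Fin n → F)) (C' : Submodule F (Fin (n + s) → F))
        (H : Matrix (Fin ℓ) (Fin n) F) (D₁ : Matrix (Fin ℓ) (Fin s) F)
        (A : Matrix (Fin m) (Fin n) F) (D₂ : Matrix (Fin m) (Fin s) F),
        IsBlockEmbedding (iterateFrobenius F p a) t C C' H D₁ A D₂ → D₂.rank = t - ℓ) ∧
    -- Euclidean case
    (∀ (t n s ℓ m : ℕ) (C : Submodule F (Fin n → F)) (C' : Submodule F (Fin (n + s) → F))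
        (H : Matrix (Fin ℓ) (Fin n) F) (D₁ : Matrix (Fin ℓ) (Fin s) F)
        (A : Matrix (Fin m) (Fin n) F) (D₂ : Matrix (Fin m) (Fin s) F),
        IsBlockEmbedding (RingHom.id F) t C C' H D₁ A D₂ →
        (IsTypeOddSquare C ∨ IsTypeOddNonsquare C ∨ IsTypeEvenNonalternating C →
          D₂.rank = t - ℓ) ∧
        (IsTypeEvenAlternating C → D₂.rank = t - ℓ ∨ D₂.rank = t - ℓ + 1)) ∧
    -- in characteristic two both values occur for codes of alternating type
    (ringChar F = 2 →
      (∃ (t n s ℓ m : ℕ) (C : Submodule F (Fin n → F)) (C' : Submodule F (Fin (n + s) → F))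
        (H : Matrix (Fin ℓ) (Fin n) F) (D₁ : Matrix (Fin ℓ) (Fin s) F)
        (A : Matrix (Fin m) (Fin n) F) (D₂ : Matrix (Fin m) (Fin s) F),
        IsBlockEmbedding (RingHom.id F) t C C' H D₁ A D₂ ∧ IsTypeEvenAlternating C ∧
          D₂.rank = t - ℓ) ∧
      (∃ (t n s ℓ m : ℕ) (C : Submodule F (Fin n → F)) (C' : Submodule F (Fin (n + s) → F))
        (H : Matrix (Fin ℓ) (Fin n) F) (D₁ : Matrix (Fin ℓ) (Fin s) F)
        (A : Matrix (Fin m) (Fin n) F) (D₂ : Matrix (Fin m) (Fin s) F),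
        IsBlockEmbedding (RingHom.id F) t C C' H D₁ A D₂ ∧ IsTypeEvenAlternating C ∧
          D₂.rank = t - ℓ + 1)) := by
  refine ⟨fun p a _ _ hF t n s ℓ m C C' H D₁ A D₂ h => rank_eq_of_hermitian hF h,
    fun t n s ℓ m C C' H D₁ A D₂ h => ⟨?_, fun hC => rank_of_alternating hC h⟩,
    fun h2 => ⟨exists_rank_eq h2, exists_rank_eq_add_one h2⟩⟩
  rintro (hC | hC | hC)
  · exact rank_eq_of_odd hC.1 h
  · exact rank_eq_of_odd hC.1 h
  · exact rank_eq_of_nonalternating hC h
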